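/- Let $n\ge 1$. A smooth convex body in $\mathbb{R}^n$ is a compact convex set with non-empty interior and $C^\infty$ boundary. For a smooth convex body $K$ and $x\in\partial K$ let $\nu_K(x)$ be the outward unit normal, and for a smooth convex body $T$ let $h_T(u)=\sup_{x\in T}\langle x,u\rangle$ be its support function. Let $K,T\subset\mathbb{R}^n$ be smooth convex bodies. A closed $(K,T)$-billiard trajectory is (the oriented image of) a piecewise smooth loop $\gamma=(q,p)\colon \mathbb{R}/2\pi\mathbb{Z}\to\partial(K\times T)$, meaning that $\gamma$ is continuous, has left and right derivatives everywhere and is smooth outside a set of measure zero, such that - $\dot\gamma(t)$ exists and is a positive multiple of $(-\nu_T(p(t)),0)$ whenever $\gamma(t)\in \mathrm{int}(K)\times\partial T$; - $\dot\gamma(t)$ exists and is a positive multiple of $(0,\nu_K(q(t)))$ whenever $\gamma(t)\in\partial K\times \mathrm{int}(T)$; - both one-sided derivatives $\dot\gamma^{\pm}(t)$ belong to $\{(-\alpha\,\nu_T(p(t)),\beta\,\nu_K(q(t))) : \alpha,\beta\ge 0,\ (\alpha,\beta)\ne(0,0)\}$ whenever $\gamma(t)\in\partial K\times\partial T$. Its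 projection $q$ is called a periodic $T$-billiard trajectory in $K$. Its length with respect to $h_T$ is $\sup\sum_{i=0}^{m-1}h_T\big(q(t_i)-q(t_{i+1})\big)$, the supremum being over all partitions $0=t_0\le t_1\le\dots\le t_m=2\pi$; if $T=B$ is the closed Euclidean unit ball, this is the usual length. Let $\xi_T(K)$ be the length of the shortest periodic $T$-billiard trajectory in $K$, and let $\xi(K)=\xi_B(K)$ be the length of the shortest periodic Euclidean billiard trajectory in $K$. Then the minimum defining $\xi_T(K)$ exists and is finite for all smooth convex bodies $K,T\subset\mathbb{R}^n$, and the following hold. 1. If $K_1\subseteq K_2$ are smooth convex bodies in $\mathbb{R}^n$, then $\xi(K_1)\le\xi(K_2)$. 2. More generally, if $K_1,T_1,K_2,T_2\subset\mathbb{R}^n$ are smooth convex bodies with $K_1\times T_1\subseteq K_2\times T_2$, then $\xi_{T_1}(K_1)\le\xi_{T_2}(K_2)$. -/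

import Mathlib

open scoped ContDiff

noncomputable section

namespace MinkowskiBilliard

/-- `ℝⁿ` with its standard inner product. -/
abbrev E (n : ℕ) := EuclideanSpace ℝ (Fin n)

/-- A smooth convex body: a compact convex set with non-empty interior whose boundary is a
`C^∞` hypersurface, i.e. near each boundary point the set is the sublevel set of a smooth
function with non-vanishing differential there. -/
structure IsSmoothConvexBody {n : ℕ} (K : Set (E n)) : Prop where
  convex : Convex ℝ K
  isCompact : IsCompact K
  interior_nonempty : (interior K).Nonempty
  smooth_frontier : ∀ x ∈ frontier K, ∃ (U : Set (E n)) (ρ : E n → ℝ),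
    IsOpen U ∧ x ∈ U ∧ ContDiffOn ℝ ∞ ρ U ∧ ρ x = 0 ∧ fderiv ℝ ρ x ≠ 0 ∧
      K ∩ U = {y ∈ U | ρ y ≤ 0}

/-- The support function `h_T(u) = sup {⟨x, u⟩ ; x ∈ T}`. -/
def supportFn {n : ℕ} (T : Set (E n)) (u : E n) : ℝ :=
  sSup ((fun x => inner ℝ x u) '' T)

/-- The outward normal cone of `K` at `x`. At a boundary point of a smooth convex body with the
origin in its interior this is the ray of nonnegative multiples of the gradient of the gauge
function of `K`; unlike the gauge, it does not depend on the position of the origin. -/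
def normalCone {n : ℕ} (K : Set (E n)) (x : E n) : Set (E n) :=
  {u | ∀ y ∈ K, 0 ≤ inner ℝ u (x - y)}

/-- A piecewise smooth map on `ℝ`: continuous, with left and right derivatives at all points,
and smooth outside a set of measure zero. -/
structure IsPiecewiseSmooth {n : ℕ} (γ : ℝ → E n × E n) : Prop where
  continuous : Continuous γ
  right_deriv : ∀ t, ∃ v, HasDerivWithinAt γ v (Set.Ici t) t
  left_deriv : ∀ t, ∃ v, HasDerivWithinAt γ v (Set.Iic t) t
  smooth_off_null : ∃ F : Set ℝ, MeasureTheory.volume F = 0 ∧ ∀ t, t ∉ F → ContDiffAt ℝ ∞ γ t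

/-- The admissible velocities at a point `(q, p)` of `∂K × ∂T`: the non-zero vectors
`(-u, w)` with `u` an outward normal of `T` at `p` and `w` an outward normal of `K` at `q`. -/
def bounceCone {n : ℕ} (K T : Set (E n)) (x : E n × E n) : Set (E n × E n) :=
  {v | v ≠ 0 ∧ ∃ u ∈ normalCone T x.2, ∃ w ∈ normalCone K x.1, v = (-u, w)}

/-- Closed `(K, T)`-billiard trajectories, parametrized by `ℝ / 2πℤ`; `γ t = (q t, p t)`.
Over the interior of `K` the point `q` moves against the outward normal of `T` at `p`, which is
fixed; over the interior of `T` the point `p` moves along the outward normal of `K` at `q`, which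
is fixed; on `∂K × ∂T` both one-sided velocities are non-zero nonnegative combinations of these
two directions. Gliding trajectories are included. The speed is not normalized, since only the
oriented image matters. -/
structure IsBilliardTrajectory {n : ℕ} (K T : Set (E n)) (γ : ℝ → E n × E n) : Prop where
  periodic : Function.Periodic γ (2 * Real.pi)
  piecewiseSmooth : IsPiecewiseSmooth γ
  mem_frontier : ∀ t, γ t ∈ frontier (K ×ˢ T)
  flight : ∀ t, (γ t).1 ∈ interior K → (γ t).2 ∈ frontier T →
    ∃ u ∈ normalCone T (γ t).2, u ≠ 0 ∧ HasDerivAt γ (-u, 0) t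
  reflection : ∀ t, (γ t).1 ∈ frontier K → (γ t).2 ∈ interior T →
    ∃ w ∈ normalCone K (γ t).1, w ≠ 0 ∧ HasDerivAt γ (0, w) t
  bounce : ∀ t, (γ t).1 ∈ frontier K → (γ t).2 ∈ frontier T →
    (∃ v ∈ bounceCone K T (γ t), HasDerivWithinAt γ v (Set.Ici t) t) ∧
    (∃ v ∈ bounceCone K T (γ t), HasDerivWithinAt γ v (Set.Iic t) t)

/-- The length, with respect to `h_T`, of a closed curve `q` parametrized by `[0, 2π]`: the
supremum of the lengths of inscribed closed polygons. An oriented edge from `a` to `b` has length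
`h_T (a - b)`, because trajectories move against the outward normals of `T`; with this orientation
the length of a trajectory is its action, and when `T` is centrally symmetric the orientation
does not matter. When `T` is the Euclidean unit ball this is the usual length. -/
def length {n : ℕ} (T : Set (E n)) (q : ℝ → E n) : EReal :=
  ⨆ (m : ℕ) (t : ℕ → ℝ) (_ : Monotone t ∧ t 0 = 0 ∧ t m = 2 * Real.pi),
    ((∑ i ∈ Finset.range m, supportFn T (q (t i) - q (t (i + 1))) : ℝ) : EReal)

/-- The lengths of all periodic `T`-billiard trajectories in `K`, that is, of the projections to
the `q`-space of the closed `(K, T)`-billiard trajectories. -/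
def billiardLengths {n : ℕ} (T K : Set (E n)) : Set EReal :=
  {ℓ | ∃ γ : ℝ → E n × E n, IsBilliardTrajectory K T γ ∧ ℓ = length T (fun t => (γ t).1)}

/-- `ξ_T(K)`: the length of the shortest periodic `T`-billiard trajectory in `K`. -/
def xiT {n : ℕ} (T K : Set (E n)) : EReal := sInf (billiardLengths T K)

/-- `ξ(K)`: the length of the shortest periodic Euclidean billiard trajectory in `K`. -/
def xi {n : ℕ} (K : Set (E n)) : EReal := xiT (Metric.closedBall 0 1) K

end MinkowskiBilliard

end

noncomputable section

namespace MinkowskiBilliard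

variable {n : ℕ}

/-! ### Support functions and normal cones -/

/-! The quantity `xiT T K` equals the least `h_T`-length of a closed polygon with at most `n + 1`
vertices that has no translate inside `interior K` (`xiT_characterization`). Both monotonicities are
then immediate: enlarging `K` leaves fewer competing polygons, and enlarging `T` increases `h_T`.

Upper bound. Take a shortest such polygon `q` with as few vertices as possible, placed inside `K`.
Hahn–Banach provides outward normals `w j` at the `q j` with sum zero
(`NotTranslatable.exists_normals`), and minimality makes all of them non-zero. After rescaling, the
functional `∑ ⟨w j, z j⟩` is dominated by the polygon length, with equality at `q`. The length is
the support function of the set of difference sequences `p j - p (j - 1)` with entries in `T`, so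
`w` is such a sequence (`exists_dual_points`). Equality at `q` makes each edge of `q` a normal of
`T` at `p j`. Alternating the moves of `q` and `p` gives a closed trajectory of the same length
(`exists_trajectory`).

Lower bound. No trajectory can be translated into `interior K`
(`IsBilliardTrajectory.exists_notMem_interior`). By Helly's theorem, `n + 1` of its points already
obstruct translation, up to a factor `r < 1`, and the trajectory is at least as long as the polygon
inscribed at these points (`IsBilliardTrajectory.le_length`). -/

lemma bddAbove_inner_image {T : Set (E n)} (hT : IsCompact T) (u : E n) :
    BddAbove ((fun x => inner ℝ x u) '' T) :=
  (hT.image (by fun_prop)).bddAbove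

lemma inner_le_supportFn {T : Set (E n)} (hT : IsCompact T) {x : E n} (hx : x ∈ T) (u : E n) :
    inner ℝ x u ≤ supportFn T u :=
  le_csSup (bddAbove_inner_image hT u) ⟨x, hx, rfl⟩

lemma supportFn_le {T : Set (E n)} (hne : T.Nonempty) {u : E n} {a : ℝ}
    (h : ∀ x ∈ T, inner ℝ x u ≤ a) : supportFn T u ≤ a := by
  refine csSup_le (hne.image _) ?_
  rintro _ ⟨x, hx, rfl⟩
  exact h x hx

lemma exists_inner_eq_supportFn {T : Set (E n)} (hT : IsCompact T) (hne : T.Nonempty) (u : E n) :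
    ∃ x ∈ T, inner ℝ x u = supportFn T u := by
  obtain ⟨x, hx, h⟩ := hT.exists_sSup_image_eq hne
    (f := fun x : E n => (inner ℝ x u : ℝ)) (by fun_prop)
  exact ⟨x, hx, h.symm⟩

lemma supportFn_zero {T : Set (E n)} (hne : T.Nonempty) : supportFn T 0 = 0 := by
  simp [supportFn, hne]

lemma supportFn_add_le {T : Set (E n)} (hT : IsCompact T) (hne : T.Nonempty) (u v : E n) :
    supportFn T (u + v) ≤ supportFn T u + supportFn T v := by
  refine supportFn_le hne fun x hx => ?_
  rw [inner_add_right]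
  exact add_le_add (inner_le_supportFn hT hx u) (inner_le_supportFn hT hx v)

lemma supportFn_sub_le {T : Set (E n)} (hT : IsCompact T) (hne : T.Nonempty) (a b c : E n) :
    supportFn T (a - c) ≤ supportFn T (a - b) + supportFn T (b - c) := by
  simpa using supportFn_add_le hT hne (a - b) (b - c)

open scoped Pointwise in
lemma supportFn_smul {T : Set (E n)} {r : ℝ} (hr : 0 ≤ r) (u : E n) :
    supportFn T (r • u) = r * supportFn T u := by
  have : (fun x : E n => (inner ℝ x (r • u) : ℝ)) '' T = r • ((fun x => inner ℝ x u) '' T) := by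
    ext y
    simp [Set.mem_smul_set, inner_smul_right]
  rw [supportFn, this, Real.sSup_smul_of_nonneg hr, smul_eq_mul, supportFn]

lemma continuous_supportFn {T : Set (E n)} (hT : IsCompact T) : Continuous (supportFn T) :=
  hT.continuous_sSup (f := fun (u x : E n) => (inner ℝ x u : ℝ)) (by fun_prop)

lemma supportFn_mono {S T : Set (E n)} (hT : IsCompact T) (hne : S.Nonempty) (h : S ⊆ T)
    (u : E n) : supportFn S u ≤ supportFn T u :=
  supportFn_le hne fun _ hx => inner_le_supportFn hT (h hx) u

lemma zero_mem_normalCone (K : Set (E n)) (x : E n) : (0 : E n) ∈ normalCone K x := by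
  simp [normalCone]

lemma smul_mem_normalCone {K : Set (E n)} {x u : E n} (hu : u ∈ normalCone K x) {r : ℝ}
    (hr : 0 ≤ r) : r • u ∈ normalCone K x := by
  intro y hy
  rw [real_inner_smul_left]
  exact mul_nonneg hr (hu y hy)

/-- A non-zero normal is positive on the vectors pointing from the interior to the base point. -/
lemma inner_pos_of_mem_normalCone {K : Set (E n)} {x u y : E n} (hu : u ∈ normalCone K x)
    (hu0 : u ≠ 0) (hy : y ∈ interior K) : 0 < inner ℝ u (x - y) := by
  have hc : ContinuousAt (fun r : ℝ => y + r • u) 0 := by fun_prop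
  have hmem : ∀ᶠ r : ℝ in nhds 0, y + r • u ∈ K := by
    refine hc.eventually ?_
    simpa using mem_interior_iff_mem_nhds.mp hy
  obtain ⟨ε, hε, h⟩ := Metric.eventually_nhds_iff.mp hmem
  have h1 := hu _ (h (y := ε / 2) (by rw [Real.dist_eq, sub_zero, abs_of_pos] <;> linarith))
  rw [← sub_sub, inner_sub_right, real_inner_smul_right] at h1
  have h2 : 0 < inner ℝ u u := real_inner_self_pos.mpr hu0
  nlinarith

lemma mem_frontier_of_normal {K : Set (E n)} {x u : E n} (hx : x ∈ K) (hu : u ∈ normalCone K x)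
    (hu0 : u ≠ 0) : x ∈ frontier K := by
  refine ⟨subset_closure hx, fun h => ?_⟩
  simpa using inner_pos_of_mem_normalCone hu hu0 h

lemma mem_normalCone_of_inner_eq_supportFn {T : Set (E n)} (hT : IsCompact T) {p u : E n}
    (h : inner ℝ p u = supportFn T u) : u ∈ normalCone T p := by
  intro y hy
  rw [inner_sub_right, real_inner_comm, h, real_inner_comm]
  exact sub_nonneg.mpr (inner_le_supportFn hT hy u)

/-- The support function is bounded below by a multiple of the norm, after recentring. -/
lemma exists_mul_norm_le_supportFn {T : Set (E n)} (hT : IsCompact T) {d : E n}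
    (hd : d ∈ interior T) :
    ∃ r > 0, ∀ u, r * ‖u‖ + inner ℝ d u ≤ supportFn T u := by
  obtain ⟨ε, hε, h⟩ := Metric.mem_nhds_iff.mp (mem_interior_iff_mem_nhds.mp hd)
  refine ⟨ε / 2, by positivity, fun u => ?_⟩
  rcases eq_or_ne u 0 with rfl | hu
  · simp [supportFn_zero ⟨d, interior_subset hd⟩]
  have hn : 0 < ‖u‖ := norm_pos_iff.mpr hu
  have hmem : d + (ε / 2 / ‖u‖) • u ∈ T := by
    apply h
    rw [Metric.mem_ball, dist_eq_norm, add_sub_cancel_left, norm_smul, Real.norm_eq_abs,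
      abs_of_pos (by positivity), div_mul_cancel₀ _ hn.ne']
    linarith
  have := inner_le_supportFn hT hmem u
  rw [inner_add_left, real_inner_smul_left, real_inner_self_eq_norm_sq] at this
  have h2 : ε / 2 / ‖u‖ * ‖u‖ ^ 2 = ε / 2 * ‖u‖ := by field_simp
  linarith

/-! ### Closed polygons -/

/-- The length of the closed polygon with the given vertices, with respect to `h_T`. -/
def polygonLength (T : Set (E n)) {m : ℕ} (z : Fin (m + 1) → E n) : ℝ :=
  ∑ j, supportFn T (z j - z (j + 1))

/-- No translate of the polygon lies in the interior of `K`. -/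
def NotTranslatable (K : Set (E n)) {m : ℕ} (z : Fin (m + 1) → E n) : Prop :=
  ∀ v, ∃ j, z j + v ∉ interior K

lemma sum_shift {m : ℕ} {M : Type*} [AddCommMonoid M] (f : Fin (m + 1) → M) (k : Fin (m + 1)) :
    ∑ j, f (j + k) = ∑ j, f j :=
  Equiv.sum_comp (Equiv.addRight k) f

lemma sum_sub_succ {m : ℕ} {M : Type*} [AddCommGroup M] (f : Fin (m + 1) → M) :
    ∑ j, (f j - f (j + 1)) = 0 := by
  rw [Finset.sum_sub_distrib, sum_shift, sub_self]

lemma polygonLength_rotate (T : Set (E n)) {m : ℕ} (z : Fin (m + 1) → E n) (k : Fin (m + 1)) :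
    polygonLength T (fun j => z (j + k)) = polygonLength T z := by
  rw [polygonLength, polygonLength, ← sum_shift (fun j => supportFn T (z j - z (j + 1))) k]
  refine Finset.sum_congr rfl fun j _ => ?_
  rw [add_right_comm]

lemma polygonLength_eq_sum_add (T : Set (E n)) {m : ℕ} (z : Fin (m + 1) → E n) :
    polygonLength T z = ∑ i : Fin m, supportFn T (z i.castSucc - z i.succ) +
      supportFn T (z (Fin.last m) - z 0) := by
  rw [polygonLength, Fin.sum_univ_castSucc]
  simp [Fin.coeSucc_eq_succ]

lemma polygonLength_smul (T : Set (E n)) {m : ℕ} {r : ℝ} (hr : 0 ≤ r) (z : Fin (m + 1) → E n) :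
    polygonLength T (fun j => r • z j) = r * polygonLength T z := by
  simp only [polygonLength, ← smul_sub, supportFn_smul hr, Finset.mul_sum]

lemma polygonLength_sub_const (T : Set (E n)) {m : ℕ} (z : Fin (m + 1) → E n) (v : E n) :
    polygonLength T (fun j => z j - v) = polygonLength T z := by
  simp [polygonLength]

lemma polygonLength_mono {S T : Set (E n)} (hT : IsCompact T) (hne : S.Nonempty) (h : S ⊆ T)
    {m : ℕ} (z : Fin (m + 1) → E n) : polygonLength S z ≤ polygonLength T z :=
  Finset.sum_le_sum fun _ _ => supportFn_mono hT hne h _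

lemma continuous_polygonLength {T : Set (E n)} (hT : IsCompact T) (m : ℕ) :
    Continuous (polygonLength T : (Fin (m + 1) → E n) → ℝ) := by
  have := continuous_supportFn hT
  unfold polygonLength
  fun_prop

/-- The recentring terms `⟨d, z i - z (i + 1)⟩` cancel around a closed polygon, so the length
controls every edge even when `T` does not contain the origin. -/
lemma exists_mul_norm_le_polygonLength {T : Set (E n)} (hT : IsCompact T)
    (hi : (interior T).Nonempty) :
    ∃ r > 0, ∀ {m : ℕ} (z : Fin (m + 1) → E n) (j : Fin (m + 1)),
      r * ‖z j - z (j + 1)‖ ≤ polygonLength T z := by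
  obtain ⟨d, hd⟩ := hi
  obtain ⟨r, hr, h⟩ := exists_mul_norm_le_supportFn hT hd
  refine ⟨r, hr, fun {m} z j => ?_⟩
  have h0 : ∑ i, (inner ℝ d (z i - z (i + 1)) : ℝ) = 0 := by
    simpa [inner_sub_right] using sum_sub_succ fun i => (inner ℝ d (z i) : ℝ)
  calc r * ‖z j - z (j + 1)‖ ≤ ∑ i, r * ‖z i - z (i + 1)‖ :=
        Finset.single_le_sum (f := fun i => r * ‖z i - z (i + 1)‖)
          (fun i _ => by positivity) (Finset.mem_univ j)
    _ = ∑ i, (r * ‖z i - z (i + 1)‖ + inner ℝ d (z i - z (i + 1))) := by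
        rw [Finset.sum_add_distrib, h0, add_zero]
    _ ≤ polygonLength T z := Finset.sum_le_sum fun i _ => h _

lemma polygonLength_nonneg {T : Set (E n)} (hT : IsCompact T) (hi : (interior T).Nonempty)
    {m : ℕ} (z : Fin (m + 1) → E n) : 0 ≤ polygonLength T z := by
  obtain ⟨r, hr, h⟩ := exists_mul_norm_le_polygonLength hT hi
  exact le_trans (by positivity) (h z 0)

lemma norm_sub_zero_le {m : ℕ} (z : Fin (m + 1) → E n) {B : ℝ}
    (h : ∀ j, ‖z j - z (j + 1)‖ ≤ B) (j : Fin (m + 1)) : ‖z j - z 0‖ ≤ j * B := by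
  induction j using Fin.induction with
  | zero => simp
  | succ i ih =>
    have h1 := h i.castSucc
    rw [Fin.coeSucc_eq_succ, norm_sub_rev] at h1
    calc ‖z i.succ - z 0‖ ≤ ‖z i.succ - z i.castSucc‖ + ‖z i.castSucc - z 0‖ :=
          norm_sub_le_norm_sub_add_norm_sub _ _ _
      _ ≤ B + (i.castSucc : ℕ) * B := add_le_add h1 ih
      _ = (i.succ : ℕ) * B := by simp; ring

lemma NotTranslatable.polygonLength_pos {K T : Set (E n)} (hK : (interior K).Nonempty)
    (hT : IsCompact T) (hi : (interior T).Nonempty) {m : ℕ} {z : Fin (m + 1) → E n}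
    (hz : NotTranslatable K z) : 0 < polygonLength T z := by
  obtain ⟨r, hr, h⟩ := exists_mul_norm_le_polygonLength hT hi
  by_contra hneg
  have hle : ∀ j, ‖z j - z (j + 1)‖ ≤ 0 := fun j => by
    by_contra hpos
    have := mul_pos hr (not_le.mp hpos)
    linarith [h z j]
  obtain ⟨c, hc⟩ := hK
  obtain ⟨j, hj⟩ := hz (c - z 0)
  have := norm_sub_zero_le z hle j
  rw [mul_zero, norm_le_zero_iff, sub_eq_zero] at this
  exact hj (by simpa [this] using hc)

lemma NotTranslatable.sub_const {K : Set (E n)} {m : ℕ} {z : Fin (m + 1) → E n}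
    (hz : NotTranslatable K z) (v : E n) : NotTranslatable K (fun j => z j - v) := by
  intro w
  obtain ⟨j, hj⟩ := hz (w - v)
  exact ⟨j, by rwa [sub_add_eq_add_sub, add_sub_assoc]⟩

lemma NotTranslatable.anti {K₁ K₂ : Set (E n)} (h : K₁ ⊆ K₂) {m : ℕ} {z : Fin (m + 1) → E n}
    (hz : NotTranslatable K₂ z) : NotTranslatable K₁ z := fun v =>
  (hz v).imp fun _ hj hk => hj (interior_mono h hk)

lemma isClosed_notTranslatable (K : Set (E n)) (m : ℕ) :
    IsClosed {z : Fin (m + 1) → E n | NotTranslatable K z} := by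
  simp only [NotTranslatable, Set.ofPred_forall, Set.ofPred_exists]
  refine isClosed_iInter fun v => isClosed_iUnion_of_finite fun j => ?_
  exact (isOpen_interior.preimage (by fun_prop)).isClosed_compl

/-- A vertex that is not needed for non-translatability can be deleted. -/
lemma exists_delete_vertex {K T : Set (E n)} (hT : IsCompact T) (hne : T.Nonempty) {m : ℕ}
    {z : Fin (m + 2) → E n} (j : Fin (m + 2))
    (hz : ∀ v, ∃ i, i ≠ j ∧ z i + v ∉ interior K) :
    ∃ z' : Fin (m + 1) → E n, NotTranslatable K z' ∧ polygonLength T z' ≤ polygonLength T z := by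
  -- The shift by `j + 1` moves vertex `j` to the last place, where `castSucc` drops it; the
  -- triangle inequality merges its two edges.
  refine ⟨fun i => z (i.castSucc + (j + 1)), fun v => ?_, ?_⟩
  · obtain ⟨i, hij, hi⟩ := hz v
    have hl : i - (j + 1) ≠ Fin.last (m + 1) := by
      intro h
      apply hij
      rw [sub_eq_iff_eq_add] at h
      rw [h, add_comm j, ← add_assoc, Fin.last_add_one, zero_add]
    obtain ⟨k, hk⟩ := Fin.exists_castSucc_eq.mpr hl
    exact ⟨k, by simpa only [hk, sub_add_cancel] using hi⟩
  · rw [← polygonLength_rotate T z (j + 1), polygonLength_eq_sum_add, polygonLength_eq_sum_add,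
      Fin.sum_univ_castSucc]
    refine le_of_le_of_eq (add_le_add (le_of_eq ?_) ?_) (add_assoc _ _ _).symm
    · simp only [Fin.succ_castSucc]
    · simp only [Fin.succ_last, Fin.castSucc_zero]
      exact supportFn_sub_le hT hne _ _ _

/-! ### Shortest non-translatable polygons -/

lemma exists_sum_inner_eq {ι : Type*} [Fintype ι] (f : (ι → E n) →L[ℝ] ℝ) :
    ∃ w : ι → E n, ∀ x, f x = ∑ j, inner ℝ (w j) (x j) := by
  classical
  refine ⟨fun j => (InnerProductSpace.toDual ℝ (E n)).symm
    (f.comp (ContinuousLinearMap.single ℝ (fun _ => E n) j)), fun x => ?_⟩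
  simp only [InnerProductSpace.toDual_symm_apply, ContinuousLinearMap.comp_apply,
    ContinuousLinearMap.single_apply]
  rw [← map_sum, Finset.univ_sum_single]

/-- A polygon in `K` with no translate in the interior has normals at its vertices that are not
all zero and add up to zero. -/
lemma NotTranslatable.exists_normals {K : Set (E n)} (hK : Convex ℝ K) (hcl : IsClosed K)
    (hi : (interior K).Nonempty) {m : ℕ} {z : Fin (m + 1) → E n} (hz : NotTranslatable K z)
    (hzK : ∀ j, z j ∈ K) :
    ∃ w : Fin (m + 1) → E n, (∀ j, w j ∈ normalCone K (z j)) ∧ ∑ j, w j = 0 ∧ ∃ j, w j ≠ 0 := by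
  classical
  -- The open convex set of polygons with all vertices in `interior K` misses the affine space of
  -- translates of `z`.
  obtain ⟨f, u, hf, hu⟩ := geometric_hahn_banach_open
    (s := Set.univ.pi fun _ : Fin (m + 1) => interior K)
    (t := Set.range fun v : E n => fun j => z j + v)
    (convex_pi fun _ _ => hK.interior)
    (isOpen_set_pi Set.finite_univ fun _ _ => isOpen_interior)
    (by
      rintro _ ⟨a, rfl⟩ _ ⟨b, rfl⟩ s t hs ht hst
      refine ⟨s • a + t • b, ?_⟩
      ext1 j
      have : z j = s • z j + t • z j := by rw [← add_smul, hst, one_smul]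
      simp only [Pi.add_apply, Pi.smul_apply, smul_add]
      nth_rewrite 1 [this]
      abel)
    (by
      rw [Set.disjoint_left]
      rintro _ hx ⟨v, rfl⟩
      obtain ⟨j, hj⟩ := hz v
      exact hj (hx j trivial))
  obtain ⟨w, hw⟩ := exists_sum_inner_eq f
  obtain ⟨c, hc⟩ := hi
  have hsum : ∀ v, f (fun j => z j + v) = f z + inner ℝ (∑ j, w j) v := fun v => by
    simp only [hw, inner_add_right, Finset.sum_add_distrib, sum_inner]
  -- A functional bounded below on all translates of `z` must be translation invariant; the multiple
  -- of `∑ w j` used below would give it the value `u - 1`.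
  have hzero : ∑ j, w j = 0 := by
    by_contra hne
    have hpos : 0 < (inner ℝ (∑ j, w j) (∑ j, w j) : ℝ) := real_inner_self_pos.mpr hne
    have := hu _ ⟨((u - f z - 1) / inner ℝ (∑ j, w j) (∑ j, w j)) • ∑ j, w j, rfl⟩
    rw [hsum, real_inner_smul_right, div_mul_cancel₀ _ hpos.ne'] at this
    linarith
  have huz : u ≤ f z := by simpa using hu _ ⟨0, rfl⟩
  have hle : ∀ y : Fin (m + 1) → E n, (∀ j, y j ∈ K) → f y ≤ u := by
    have hsub : closure (Set.univ.pi fun _ : Fin (m + 1) => interior K) ⊆ {y | f y ≤ u} :=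
      closure_minimal (fun y hy => (hf y hy).le) (isClosed_le f.continuous continuous_const)
    intro y hy
    refine hsub ?_
    rw [closure_pi_set, hK.closure_interior_eq_closure_of_nonempty_interior ⟨c, hc⟩, hcl.closure_eq]
    exact fun j _ => hy j
  refine ⟨w, fun j y hy => ?_, hzero, ?_⟩
  -- Since `z` maximizes `f` over polygons in `K`, moving one vertex at a time isolates the
  -- inequality for `w j`.
  · have h1 := (hle (Function.update z j y) fun i => by
      rcases eq_or_ne i j with rfl | h
      · simpa using hy
      · simpa [h] using hzK i).trans huz
    have h2 : f z - f (Function.update z j y) = inner ℝ (w j) (z j - y) := by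
      rw [hw, hw, ← Finset.sum_sub_distrib, Finset.sum_eq_single j]
      · simp [inner_sub_right]
      · intro i _ hij
        simp [hij]
      · simp
    linarith
  · by_contra! hall
    have h1 := hf (fun _ => c) fun _ _ => hc
    have h2 : f (fun _ => c) = 0 := by simp [hw, hall]
    have h3 : f z = 0 := by simp [hw, hall]
    linarith

/-- Normals with sum zero certify non-translatability: the functional `∑ ⟨w j, ·⟩` ignores
translations and is strictly smaller on the interior than at `z`. Only vertices with `w j ≠ 0`
matter, which allows the others to be deleted. -/
lemma NotTranslatable.of_normals {K : Set (E n)} {m : ℕ} {z w : Fin (m + 1) → E n}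
    (hw : ∀ j, w j ∈ normalCone K (z j)) (h0 : ∃ j, w j ≠ 0) {z' : Fin (m + 1) → E n}
    (hle : ∑ j, inner ℝ (w j) (z j) ≤ ∑ j, (inner ℝ (w j) (z' j) : ℝ)) (hsum : ∑ j, w j = 0)
    (v : E n) : ∃ j, w j ≠ 0 ∧ z' j + v ∉ interior K := by
  by_contra! hall
  have hv : ∑ j, (inner ℝ (w j) v : ℝ) = 0 := by rw [← sum_inner, hsum, inner_zero_left]
  have hlt : 0 < ∑ j, (inner ℝ (w j) (z j - (z' j + v)) : ℝ) := by
    obtain ⟨i, hi⟩ := h0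
    refine Finset.sum_pos' (fun j _ => ?_) ⟨i, Finset.mem_univ i,
      inner_pos_of_mem_normalCone (hw i) hi (hall i hi)⟩
    rcases eq_or_ne (w j) 0 with h | h
    · simp [h]
    · exact (inner_pos_of_mem_normalCone (hw j) h (hall j h)).le
  simp only [inner_sub_right, inner_add_right, Finset.sum_sub_distrib, Finset.sum_add_distrib,
    hv] at hlt
  linarith

lemma exists_shortest_polygon {K T : Set (E n)} (hT : IsCompact T) (hi : (interior T).Nonempty)
    {m : ℕ} (hne : ∃ z : Fin (m + 1) → E n, NotTranslatable K z) :
    ∃ z : Fin (m + 1) → E n, NotTranslatable K z ∧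
      ∀ z' : Fin (m + 1) → E n, NotTranslatable K z' → polygonLength T z ≤ polygonLength T z' := by
  obtain ⟨z₁, hz₁⟩ := hne
  obtain ⟨r, hr, h⟩ := exists_mul_norm_le_polygonLength hT hi
  -- Pinning the first vertex at the origin removes the translation freedom, so the length bound
  -- gives compactness.
  set S : Set (Fin (m + 1) → E n) := {z | NotTranslatable K z} ∩ {z | z 0 = 0} ∩
    {z | polygonLength T z ≤ polygonLength T z₁}
  have hcl : IsClosed S :=
    ((isClosed_notTranslatable K m).inter (isClosed_eq (by fun_prop) continuous_const)).inter
      (isClosed_le (continuous_polygonLength hT m) continuous_const)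
  have hbdd : Bornology.IsBounded S := by
    refine isBounded_iff_forall_norm_le.mpr ⟨m * (polygonLength T z₁ / r), fun z hz => ?_⟩
    have hB : 0 ≤ polygonLength T z₁ / r := div_nonneg (polygonLength_nonneg hT hi z₁) hr.le
    rw [pi_norm_le_iff_of_nonneg (by positivity)]
    intro j
    have h1 : ∀ j, ‖z j - z (j + 1)‖ ≤ polygonLength T z₁ / r := fun j => by
      rw [le_div_iff₀ hr, mul_comm]
      exact (h z j).trans hz.2
    have h2 := norm_sub_zero_le z h1 j
    rw [show z 0 = 0 from hz.1.2, sub_zero] at h2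
    have h3 : ((j : ℕ) : ℝ) ≤ m := by exact_mod_cast Nat.lt_succ_iff.mp j.2
    exact h2.trans (mul_le_mul_of_nonneg_right h3 hB)
  have hS₁ : (fun j => z₁ j - z₁ 0) ∈ S :=
    ⟨⟨hz₁.sub_const _, sub_self _⟩, (polygonLength_sub_const T z₁ _).le⟩
  obtain ⟨z, hzS, hz⟩ := (Metric.isCompact_of_isClosed_isBounded hcl hbdd).exists_isMinOn ⟨_, hS₁⟩
    (continuous_polygonLength hT m).continuousOn
  refine ⟨z, hzS.1.1, fun z' hz' => ?_⟩
  by_cases hle : polygonLength T z' ≤ polygonLength T z₁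
  · have : polygonLength T z ≤ polygonLength T (fun j => z' j - z' 0) :=
      hz ⟨⟨hz'.sub_const _, sub_self _⟩, (polygonLength_sub_const T z' _).le.trans hle⟩
    rwa [polygonLength_sub_const] at this
  · exact hzS.2.trans (not_le.mp hle).le

lemma exists_notTranslatable (hn : 1 ≤ n) {K : Set (E n)} (hK : IsCompact K) :
    ∃ z : Fin 2 → E n, NotTranslatable K z := by
  have : Nonempty (Fin n) := ⟨⟨0, hn⟩⟩
  obtain ⟨R, hR⟩ := hK.isBounded.exists_norm_le
  obtain ⟨e, he⟩ := exists_norm_eq (E n) (c := 2 * |R| + 1) (by positivity)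
  refine ⟨![0, e], fun v => ?_⟩
  by_contra! hall
  have h0 := hR _ (interior_subset (hall 0))
  have h1 := hR _ (interior_subset (hall 1))
  simp only [Matrix.cons_val_zero, Matrix.cons_val_one, zero_add] at h0 h1
  have := norm_sub_le (e + v) v
  rw [add_sub_cancel_right] at this
  linarith [le_abs_self R]

/-- Among the non-translatable polygons with at most `n + 1` vertices there is a shortest one;
choose one with the least number of vertices. -/
lemma exists_shortest_polygon_of_le (hn : 1 ≤ n) {K T : Set (E n)} (hK : IsCompact K)
    (hT : IsCompact T) (hi : (interior T).Nonempty) :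
    ∃ m ≤ n, ∃ z : Fin (m + 1) → E n, NotTranslatable K z ∧
      (∀ m' ≤ n, ∀ z' : Fin (m' + 1) → E n, NotTranslatable K z' →
        polygonLength T z ≤ polygonLength T z') ∧
      ∀ m' < m, ∀ z' : Fin (m' + 1) → E n, NotTranslatable K z' →
        polygonLength T z < polygonLength T z' := by
  classical
  let P : ℕ → Prop := fun m => m ≤ n ∧ ∃ z : Fin (m + 1) → E n, NotTranslatable K z ∧
      ∀ m' ≤ n, ∀ z' : Fin (m' + 1) → E n, NotTranslatable K z' →
        polygonLength T z ≤ polygonLength T z'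
  have hP : ∃ m, P m := by
    choose! z hz hmin using fun (m : ℕ) (h : ∃ z : Fin (m + 1) → E n, NotTranslatable K z) =>
      exists_shortest_polygon hT hi h
    obtain ⟨m, hm, hle⟩ := Finset.exists_min_image
      ((Finset.range (n + 1)).filter fun m => ∃ z : Fin (m + 1) → E n, NotTranslatable K z)
      (fun m => polygonLength T (z m))
      ⟨1, by simpa [Nat.pos_of_ne_zero (Nat.one_le_iff_ne_zero.mp hn)] using exists_notTranslatable hn hK⟩
    simp only [Finset.mem_filter, Finset.mem_range, Nat.lt_succ_iff] at hm hle
    exact ⟨m, hm.1, z m, hz m hm.2, fun m' hm' z' hz' =>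
      (hle m' ⟨hm', z', hz'⟩).trans (hmin m' ⟨z', hz'⟩ z' hz')⟩
  obtain ⟨hm, z, hz, hmin⟩ := Nat.find_spec hP
  refine ⟨Nat.find hP, hm, z, hz, hmin, fun m' hm' z' hz' => ?_⟩
  by_contra hle
  -- A polygon with fewer vertices that is no longer than `z` would itself be a minimizer.
  exact Nat.find_min hP hm' ⟨hm'.le.trans hm, z', hz', fun k hk y hy =>
    (not_lt.mp hle).trans (hmin k hk y hy)⟩

/-- A shortest non-translatable polygon has a translate in `K`. -/
lemma exists_translate_mem {K T : Set (E n)} (hK : IsCompact K) (hKi : (interior K).Nonempty)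
    (hT : IsCompact T) (hi : (interior T).Nonempty) {m : ℕ} {z : Fin (m + 1) → E n}
    (hz : NotTranslatable K z) (hmin : ∀ z' : Fin (m + 1) → E n, NotTranslatable K z' →
      polygonLength T z ≤ polygonLength T z') :
    ∃ v, ∀ j, z j - v ∈ K := by
  have hpos := hz.polygonLength_pos hKi hT hi
  -- Shrinking strictly shortens the polygon, so by minimality the shrunken copy fits into the
  -- interior; then let the factor tend to 1.
  have key : ∀ k : ℕ, ∃ v, ∀ j, (1 - 1 / ((k : ℝ) + 1)) • z j + v ∈ interior K := fun k => by
    by_contra! hall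
    have hk : 1 / ((k : ℝ) + 1) ≤ 1 := by
      rw [div_le_one (by positivity)]
      linarith [(Nat.cast_nonneg k : (0 : ℝ) ≤ k)]
    have hk' : 0 < 1 / ((k : ℝ) + 1) := by positivity
    have := hmin _ hall
    rw [polygonLength_smul T (sub_nonneg.mpr hk)] at this
    nlinarith
  choose v hv using key
  obtain ⟨x, -, φ, hφ, hx⟩ := hK.tendsto_subseq fun k => interior_subset (hv k 0)
  refine ⟨z 0 - x, fun j => ?_⟩
  have hlim : Filter.Tendsto (fun k => (1 - 1 / ((φ k : ℝ) + 1)) • z 0 + v (φ k) +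
      (1 - 1 / ((φ k : ℝ) + 1)) • (z j - z 0)) Filter.atTop
      (nhds (x + (1 - 0 : ℝ) • (z j - z 0))) := by
    refine hx.add (Filter.Tendsto.smul_const (Filter.Tendsto.const_sub _ ?_) _)
    exact tendsto_one_div_add_atTop_nhds_zero_nat.comp hφ.tendsto_atTop
  rw [sub_zero, one_smul] at hlim
  have : z j - (z 0 - x) = x + (z j - z 0) := by abel
  rw [this]
  refine hK.isClosed.mem_of_tendsto hlim (Filter.Eventually.of_forall fun k => ?_)
  have h := interior_subset (hv (φ k) j)
  rwa [smul_sub, add_comm _ (v (φ k)), add_assoc, add_sub_cancel, add_comm]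

/-- A polygonal length that dominates `∑ ⟨w j, z j⟩` comes with dual points `p j ∈ T` whose
differences are the `w j`. -/
lemma exists_dual_points {T : Set (E n)} (hT : IsCompact T) (hTc : Convex ℝ T)
    (hne : T.Nonempty) {m : ℕ} {w : Fin (m + 1) → E n}
    (h : ∀ z : Fin (m + 1) → E n, ∑ j, inner ℝ (w j) (z j) ≤ polygonLength T z) :
    ∃ p : Fin (m + 1) → E n, (∀ j, p j ∈ T) ∧ ∀ j, w j = p j - p (j - 1) := by
  let D : (Fin (m + 1) → E n) →ₗ[ℝ] (Fin (m + 1) → E n) :=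
    { toFun := fun p j => p j - p (j - 1)
      map_add' := fun p q => by ext1 j; simp only [Pi.add_apply]; abel
      map_smul' := fun r p => by ext1 j; simp [smul_sub] }
  have hD : Continuous D := by
    change Continuous fun (p : Fin (m + 1) → E n) j => p j - p (j - 1)
    fun_prop
  have hconv : Convex ℝ (D '' Set.univ.pi fun _ => T) :=
    (convex_pi fun _ _ => hTc).linear_image D
  have hcomp : IsCompact (D '' Set.univ.pi fun _ => T) :=
    (isCompact_univ_pi fun _ => hT).image hD
  suffices hw : w ∈ D '' Set.univ.pi fun _ => T by
    obtain ⟨p, hp, rfl⟩ := hw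
    exact ⟨p, fun j => hp j trivial, fun j => rfl⟩
  by_contra hw
  obtain ⟨f, u, hf, hu⟩ := geometric_hahn_banach_closed_point hconv hcomp.isClosed hw
  obtain ⟨z, hz⟩ := exists_sum_inner_eq f
  -- These maximizers show that `polygonLength T z` is attained as a value of `f` on the image of
  -- `D`, contradicting the separation.
  choose p hpT hp using fun j => exists_inner_eq_supportFn hT hne (z j - z (j + 1))
  have h1 : f (D p) = polygonLength T z := by
    rw [hz, polygonLength]
    change ∑ j, inner ℝ (z j) (p j - p (j - 1)) = _
    simp only [inner_sub_right, Finset.sum_sub_distrib, ← hp]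
    rw [← sum_shift (fun j => (inner ℝ (z j) (p (j - 1)) : ℝ)) 1]
    simp only [add_sub_cancel_right, real_inner_comm]
  have h2 := hf _ ⟨p, fun j _ => hpT j, rfl⟩
  have h3 := h z
  have h4 : f w = ∑ j, inner ℝ (w j) (z j) :=
    (hz w).trans (Finset.sum_congr rfl fun j _ => real_inner_comm _ _)
  linarith

/-- The vertices `q j` of a shortest polygon, and the dual points `p j`, are the bounce points of a
billiard trajectory. -/
lemma exists_bounce_points (hn : 1 ≤ n) {K T : Set (E n)} (hK : IsCompact K) (hKc : Convex ℝ K)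
    (hKi : (interior K).Nonempty) (hT : IsCompact T) (hTc : Convex ℝ T)
    (hTi : (interior T).Nonempty) :
    ∃ m ≤ n, ∃ q p : Fin (m + 1) → E n, NotTranslatable K q ∧
      (∀ m' ≤ n, ∀ z' : Fin (m' + 1) → E n, NotTranslatable K z' →
        polygonLength T q ≤ polygonLength T z') ∧
      ∀ j, q j ∈ frontier K ∧ p j ∈ frontier T ∧ q j - q (j + 1) ≠ 0 ∧ p j - p (j - 1) ≠ 0 ∧
        p j - p (j - 1) ∈ normalCone K (q j) ∧ q j - q (j + 1) ∈ normalCone T (p j) := by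
  have hne := hTi.mono interior_subset
  obtain ⟨m, hm, z, hz, hmin, hless⟩ := exists_shortest_polygon_of_le hn hK hT hTi
  obtain ⟨v, hv⟩ := exists_translate_mem hK hKi hT hTi hz (hmin m hm)
  obtain ⟨q, hqz⟩ : ∃ q : Fin (m + 1) → E n, q = fun j => z j - v := ⟨_, rfl⟩
  replace hz := hz.sub_const v
  simp only [← polygonLength_sub_const T z v] at hmin hless
  rw [← hqz] at hz hmin hless
  replace hv : ∀ j, q j ∈ K := fun j => hqz ▸ hv j
  clear hqz z
  obtain ⟨k, rfl⟩ : ∃ k, m = k + 1 := by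
    refine Nat.exists_eq_succ_of_ne_zero ?_
    rintro rfl
    obtain ⟨c, hc⟩ := hKi
    obtain ⟨j, hj⟩ := hz (c - q 0)
    rw [show j = 0 from Fin.fin_one_eq_zero j, add_sub_cancel] at hj
    exact hj hc
  -- No vertex is superfluous, because the number of vertices is least. This makes all edges and all
  -- normals non-zero.
  have hdel : ∀ j, ¬ ∀ v, ∃ i, i ≠ j ∧ q i + v ∉ interior K := by
    intro j hj
    obtain ⟨z', hz', hle⟩ := exists_delete_vertex hT hne j hj
    exact (hless k k.lt_succ_self z' hz').not_ge hle
  obtain ⟨w, hwN, hsum, hw0⟩ := hz.exists_normals hKc hK.isClosed hKi hv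
  have hqne : ∀ j, q j - q (j + 1) ≠ 0 := fun j hj => hdel j fun v => by
    obtain ⟨i, hi⟩ := hz v
    rcases eq_or_ne i j with rfl | hij
    · exact ⟨i + 1, fun h => Fin.zero_lt_one.ne' (add_eq_left.mp h), by rwa [← sub_eq_zero.mp hj]⟩
    · exact ⟨i, hij, hi⟩
  have hwne : ∀ j, w j ≠ 0 := fun j hj => hdel j fun v => by
    obtain ⟨i, hi, hi'⟩ := NotTranslatable.of_normals hwN hw0 le_rfl hsum v
    exact ⟨i, fun h => hi (h ▸ hj), hi'⟩
  obtain ⟨c, hc⟩ := hKi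
  set a := ∑ j, (inner ℝ (w j) (q j) : ℝ) with ha
  have hapos : 0 < a := by
    have : a = ∑ j, (inner ℝ (w j) (q j - c) : ℝ) := by
      simp only [inner_sub_right, Finset.sum_sub_distrib, ← sum_inner, hsum, inner_zero_left,
        sub_zero, ha]
    rw [this]
    exact Finset.sum_pos (fun j _ => inner_pos_of_mem_normalCone (hwN j) (hwne j) hc)
      Finset.univ_nonempty
  -- This factor makes the functional agree with the length at `q`. If its sum `b` at `z` is
  -- positive, `(a / b) • z` is again non-translatable, and minimality of `q` gives the domination.
  set lam := polygonLength T q / a with hlam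
  have hlampos : 0 < lam := div_pos (hz.polygonLength_pos ⟨c, hc⟩ hT hTi) hapos
  have hbound : ∀ z : Fin (k + 2) → E n,
      ∑ j, inner ℝ (lam • w j) (z j) ≤ polygonLength T z := fun z => by
    simp only [real_inner_smul_left, ← Finset.mul_sum]
    set b := ∑ j, (inner ℝ (w j) (z j) : ℝ) with hb
    rcases le_or_gt b 0 with hb0 | hb0
    · exact (mul_nonpos_of_nonneg_of_nonpos hlampos.le hb0).trans (polygonLength_nonneg hT hTi z)
    · have hr : 0 < a / b := div_pos hapos hb0
      have h1 : NotTranslatable K fun j => (a / b) • z j := fun v => by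
        obtain ⟨j, -, hj⟩ := NotTranslatable.of_normals (z' := fun j => (a / b) • z j) hwN hw0
          (by simp only [real_inner_smul_right, ← Finset.mul_sum, ← hb, ← ha,
                div_mul_cancel₀ _ hb0.ne', le_refl]) hsum v
        exact ⟨j, hj⟩
      have h2 := hmin (k + 1) hm _ h1
      rw [polygonLength_smul T hr.le] at h2
      rw [hlam, div_mul_eq_mul_div, div_le_iff₀ hapos]
      rw [div_mul_eq_mul_div, le_div_iff₀ hb0] at h2
      linarith
  obtain ⟨p, hpT, hp⟩ := exists_dual_points hT hTc hne hbound
  have heq : ∑ j, inner ℝ (p j) (q j - q (j + 1)) = ∑ j, supportFn T (q j - q (j + 1)) := by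
    have h1 : lam * a = polygonLength T q := div_mul_cancel₀ _ hapos.ne'
    rw [ha, Finset.mul_sum] at h1
    simp only [← real_inner_smul_left, hp, inner_sub_left, Finset.sum_sub_distrib] at h1
    rw [← sum_shift (fun j => (inner ℝ (p (j - 1)) (q j) : ℝ)) 1] at h1
    simp only [add_sub_cancel_right] at h1
    simp only [inner_sub_right, Finset.sum_sub_distrib]
    exact h1
  rw [Finset.sum_eq_sum_iff_of_le fun j _ => inner_le_supportFn hT (hpT j) _] at heq
  have hqN : ∀ j, q j - q (j + 1) ∈ normalCone T (p j) := fun j =>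
    mem_normalCone_of_inner_eq_supportFn hT (heq j (Finset.mem_univ j))
  refine ⟨k + 1, hm, q, p, hz, hmin, fun j => ⟨mem_frontier_of_normal (hv j) (hwN j) (hwne j),
    mem_frontier_of_normal (hpT j) (hqN j) (hqne j), hqne j, ?_, ?_, hqN j⟩⟩
  · rw [← hp]
    exact smul_ne_zero hlampos.ne' (hwne j)
  · rw [← hp]
    exact smul_mem_normalCone (hwN j) hlampos.le

/-! ### Trajectories cannot be translated into the interior -/

/-- A nonincreasing function that returns to its initial value is constant in between. -/
lemma right_deriv_eq_zero_of_nonpos {f f' : ℝ → ℝ} {L : ℝ} (hf : Continuous f)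
    (hf' : ∀ t, HasDerivWithinAt f (f' t) (Set.Ici t) t) (hle : ∀ t, f' t ≤ 0)
    (hL : f L = f 0) {t : ℝ} (ht : t ∈ Set.Ico 0 L) : f' t = 0 := by
  have hanti : ∀ a b, a ≤ b → f b ≤ f a := fun a b hab =>
    image_le_of_deriv_right_le_deriv_boundary (B := fun _ => f a) (B' := fun _ => 0)
      hf.continuousOn (fun x _ => hf' x) le_rfl continuousOn_const
      (fun x _ => hasDerivWithinAt_const _ _ _) (fun x _ => hle x) (Set.right_mem_Icc.mpr hab)
  have hconst : ∀ s ∈ Set.Ico t L, f s = f t := fun s hs =>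
    le_antisymm (hanti _ _ hs.1) <|
      (hanti 0 t ht.1).trans (hL ▸ hanti s L hs.2.le)
  have h0 : HasDerivWithinAt f 0 (Set.Ici t) t := by
    refine (hasDerivWithinAt_const t (Set.Ici t) (f t)).congr_of_eventuallyEq ?_ rfl
    filter_upwards [Ico_mem_nhdsGE ht.2] with s hs using hconst s hs
  exact (uniqueDiffWithinAt_Ici t).eq_deriv _ (hf' t) h0

lemma IsBilliardTrajectory.mem {K T : Set (E n)} (hK : IsClosed K) (hT : IsClosed T)
    {γ : ℝ → E n × E n} (h : IsBilliardTrajectory K T γ) (t : ℝ) :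
    (γ t).1 ∈ K ∧ (γ t).2 ∈ T ∧ ((γ t).1 ∈ interior K ∧ (γ t).2 ∈ frontier T ∨
      (γ t).1 ∈ frontier K ∧ (γ t).2 ∈ interior T ∨
      (γ t).1 ∈ frontier K ∧ (γ t).2 ∈ frontier T) := by
  have h1 := h.mem_frontier t
  rw [frontier_prod_eq, hK.closure_eq, hT.closure_eq] at h1
  have hsplit : ∀ {S : Set (E n)} {x}, IsClosed S → x ∈ S → x ∈ interior S ∨ x ∈ frontier S :=
    fun {S x} hS hx => by
      rw [hS.frontier_eq]
      exact (em (x ∈ interior S)).imp_right fun h => ⟨hx, h⟩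
  rcases h1 with ⟨h1, h2⟩ | ⟨h1, h2⟩
  · refine ⟨h1, hT.frontier_subset h2, ?_⟩
    rcases hsplit hK h1 with h | h <;> tauto
  · refine ⟨hK.frontier_subset h1, h2, ?_⟩
    rcases hsplit hT h2 with h | h <;> tauto

/-- At each time the right velocity is `(-u, w)` with `u`, `w` outward normals, not both zero. -/
lemma IsBilliardTrajectory.exists_right_velocity {K T : Set (E n)} (hK : IsClosed K)
    (hT : IsClosed T) {γ : ℝ → E n × E n} (h : IsBilliardTrajectory K T γ) (t : ℝ) :
    ∃ u ∈ normalCone T (γ t).2, ∃ w ∈ normalCone K (γ t).1, (w = 0 → u ≠ 0) ∧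
      HasDerivWithinAt γ (-u, w) (Set.Ici t) t := by
  rcases (h.mem hK hT t).2.2 with ⟨h1, h2⟩ | ⟨h1, h2⟩ | ⟨h1, h2⟩
  · obtain ⟨u, hu, hu0, hd⟩ := h.flight t h1 h2
    exact ⟨u, hu, 0, zero_mem_normalCone _ _, fun _ => hu0, hd.hasDerivWithinAt⟩
  · obtain ⟨w, hw, hw0, hd⟩ := h.reflection t h1 h2
    exact ⟨0, zero_mem_normalCone _ _, w, hw, fun h => (hw0 h).elim, by
      simpa using hd.hasDerivWithinAt⟩
  · obtain ⟨⟨v, ⟨hv0, u, hu, w, hw, rfl⟩, hd⟩, -⟩ := h.bounce t h1 h2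
    refine ⟨u, hu, w, hw, ?_, hd⟩
    rintro rfl rfl
    simp at hv0

/-- If `q + v` stayed in the interior, `⟨v, p⟩` would decrease strictly whenever `p` moves, so by
periodicity `p` is constant. Then `q` always moves against normals at one fixed point of `T`, and
`⟨p - d, q⟩` with `d` interior to `T` cannot return to its initial value. -/
lemma IsBilliardTrajectory.exists_notMem_interior {K T : Set (E n)} (hK : IsClosed K)
    (hT : IsClosed T) (hTi : (interior T).Nonempty) {γ : ℝ → E n × E n}
    (h : IsBilliardTrajectory K T γ) (v : E n) :
    ∃ t ∈ Set.Icc 0 (2 * Real.pi), (γ t).1 + v ∉ interior K := by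
  by_contra! hall'
  have hall : ∀ t, (γ t).1 + v ∈ interior K := fun t => by
    obtain ⟨s, hs, he⟩ := h.periodic.exists_mem_Ico₀ Real.two_pi_pos t
    rw [he]
    exact hall' s ⟨hs.1, hs.2.le⟩
  choose u hu w hw huw hd using h.exists_right_velocity hK hT
  have hd1 : ∀ t, HasDerivWithinAt (fun t => (γ t).1) (-u t) (Set.Ici t) t := fun t =>
    (hasFDerivAt_fst (𝕜 := ℝ) (p := γ t)).comp_hasDerivWithinAt t (hd t)
  have hd2 : ∀ t, HasDerivWithinAt (fun t => (γ t).2) (w t) (Set.Ici t) t := fun t =>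
    (hasFDerivAt_snd (𝕜 := ℝ) (p := γ t)).comp_hasDerivWithinAt t (hd t)
  have hc := h.piecewiseSmooth.continuous
  have hper : γ (2 * Real.pi) = γ 0 := by simpa using h.periodic 0
  have hinner : ∀ (a : E n) {f : ℝ → E n} {f' : E n} {t : ℝ},
      HasDerivWithinAt f f' (Set.Ici t) t →
      HasDerivWithinAt (fun t => (inner ℝ a (f t) : ℝ)) (inner ℝ a f') (Set.Ici t) t :=
    fun a f f' t hf => (innerSL ℝ a).hasFDerivAt.comp_hasDerivWithinAt t hf
  have hneg : ∀ t, w t ≠ 0 → (inner ℝ v (w t) : ℝ) < 0 := fun t ht => by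
    have := inner_pos_of_mem_normalCone (hw t) ht (hall t)
    rw [sub_add_cancel_left, inner_neg_right, real_inner_comm] at this
    linarith
  have hw0 : ∀ t ∈ Set.Ico 0 (2 * Real.pi), w t = 0 := fun t ht => by
    by_contra hne
    refine (hneg t hne).ne (right_deriv_eq_zero_of_nonpos (f := fun t => inner ℝ v (γ t).2)
      (f' := fun t => inner ℝ v (w t)) (by fun_prop) (fun t => hinner v (hd2 t))
      (fun t => ?_) (by simp only [hper]) ht)
    rcases eq_or_ne (w t) 0 with h0 | h0
    · simp [h0]
    · exact (hneg t h0).le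
  have hp : ∀ t ∈ Set.Icc 0 (2 * Real.pi), (γ t).2 = (γ 0).2 :=
    constant_of_has_deriv_right_zero (by fun_prop) fun t ht => hw0 t ht ▸ hd2 t
  obtain ⟨d, hdT⟩ := hTi
  have hp' : ∀ t, (γ t).2 = (γ 0).2 := fun t => by
    obtain ⟨s, hs, he⟩ := h.periodic.exists_mem_Ico₀ Real.two_pi_pos t
    rw [he]
    exact hp s ⟨hs.1, hs.2.le⟩
  have h0mem : (0 : ℝ) ∈ Set.Ico 0 (2 * Real.pi) := ⟨le_rfl, Real.two_pi_pos⟩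
  have hpos := inner_pos_of_mem_normalCone (hu 0) (huw 0 (hw0 0 h0mem)) hdT
  have := right_deriv_eq_zero_of_nonpos (f := fun t => inner ℝ ((γ 0).2 - d) (γ t).1)
    (f' := fun t => inner ℝ ((γ 0).2 - d) (-u t)) (by fun_prop) (fun t => hinner _ (hd1 t))
    (fun t => by
      have := hu t d (interior_subset hdT)
      rw [hp' t, real_inner_comm] at this
      rw [inner_neg_right]
      linarith) (by simp only [hper]) h0mem
  rw [inner_neg_right, real_inner_comm] at this
  linarith

/-- A closed curve is at least as long as any inscribed polygon. -/
lemma polygonLength_le_length {T : Set (E n)} (hT : IsCompact T) (hne : T.Nonempty) {q : ℝ → E n}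
    (hq : q (2 * Real.pi) = q 0) {m : ℕ} {t : Fin (m + 1) → ℝ} (ht : Monotone t)
    (hmem : ∀ j, t j ∈ Set.Icc 0 (2 * Real.pi)) :
    ((polygonLength T fun j => q (t j) : ℝ) : EReal) ≤ length T q := by
  -- The partition is `0, t 0, …, t m, 2π`, constant afterwards. The closing edge of the polygon is
  -- compared with the detour through `q 0 = q (2π)`.
  let τ : ℕ → ℝ := Nat.rec 0 fun i _ => if h : i < m + 1 then t ⟨i, h⟩ else 2 * Real.pi
  have hτ0 : τ 0 = 0 := rfl
  have hτs : ∀ i (h : i < m + 1), τ (i + 1) = t ⟨i, h⟩ := fun i h => dif_pos h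
  have hτg : ∀ i, ¬ i < m + 1 → τ (i + 1) = 2 * Real.pi := fun i h => dif_neg h
  have hτl : τ (m + 2) = 2 * Real.pi := hτg (m + 1) (lt_irrefl _)
  have hτm : Monotone τ := by
    refine monotone_nat_of_le_succ fun i => ?_
    rcases i with _ | i
    · rw [hτ0, hτs 0 (Nat.succ_pos m)]
      exact (hmem _).1
    · by_cases h1 : i + 1 < m + 1
      · rw [hτs i (by omega), hτs (i + 1) h1]
        exact ht (by simp [Fin.le_def])
      · rw [hτg (i + 1) h1]
        by_cases h3 : i < m + 1
        · rw [hτs i h3]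
          exact (hmem _).2
        · rw [hτg i h3]
  refine le_trans (EReal.coe_le_coe_iff.mpr ?_)
    (le_iSup_of_le (m + 2) (le_iSup_of_le τ (le_iSup_of_le ⟨hτm, hτ0, hτl⟩ le_rfl)))
  rw [polygonLength_eq_sum_add, Finset.sum_range_succ, Finset.sum_range_succ', hτ0, hτl,
    hτs 0 (Nat.succ_pos m), hτs m (Nat.lt_succ_self m), hq, Finset.sum_range, add_assoc]
  refine add_le_add (le_of_eq (Finset.sum_congr rfl fun i _ => ?_)) ?_
  · rw [hτs i (by omega), hτs (i + 1) (by omega)]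
    rfl
  · exact (supportFn_sub_le hT hne _ _ _).trans_eq (add_comm _ _)

lemma IsBilliardTrajectory.le_length {K T : Set (E n)} (hK : IsCompact K) (hKc : Convex ℝ K)
    (hKi : (interior K).Nonempty) (hT : IsCompact T) (hTi : (interior T).Nonempty) {μ : ℝ}
    (hμ : ∀ z : Fin (n + 1) → E n, NotTranslatable K z → μ ≤ polygonLength T z)
    {γ : ℝ → E n × E n} (h : IsBilliardTrajectory K T γ) :
    (μ : EReal) ≤ length T fun t => (γ t).1 := by
  obtain ⟨c, hc⟩ := hKi
  have hper : γ (2 * Real.pi) = γ 0 := by simpa using h.periodic 0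
  have key : ∀ r : ℝ, 0 < r → r < 1 → ((r * μ : ℝ) : EReal) ≤ length T fun t => (γ t).1 := by
    intro r hr0 hr1
    -- `C t` consists of the translations taking `q t` into the copy of `K` shrunk towards `c`. The
    -- shrunken copy is compact, as Helly for an infinite family requires, and lies in `interior K`.
    let C : Set.Icc 0 (2 * Real.pi) → Set (E n) := fun t =>
      (fun x => (1 - r) • c + r • x - (γ t).1) '' K
    have hCconv : ∀ t, Convex ℝ (C t) := fun t => by
      have : C t = (fun x => ((1 - r) • c - (γ t).1) + x) '' ((fun x => r • x) '' K) := by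
        rw [Set.image_image]
        exact Set.image_congr fun x _ => by abel
      rw [this]
      exact (hKc.smul r).translate _
    have hCcomp : ∀ t, IsCompact (C t) := fun t => hK.image (by fun_prop)
    have hempty : ¬ (⋂ t, C t).Nonempty := by
      rintro ⟨v, hv⟩
      rw [Set.mem_iInter] at hv
      obtain ⟨t, ht, hnot⟩ := h.exists_notMem_interior hK.isClosed hT.isClosed hTi v
      obtain ⟨x, hx, hxv⟩ := hv ⟨t, ht⟩
      refine hnot ?_
      rw [← hxv, add_sub_cancel]
      exact hKc.combo_interior_self_mem_interior hc hx (by linarith) hr0.le (by ring)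
    have hinf : Infinite (Set.Icc 0 (2 * Real.pi)) :=
      (Set.Icc_infinite Real.two_pi_pos).to_subtype
    obtain ⟨I, hIc, hI⟩ : ∃ I : Finset (Set.Icc 0 (2 * Real.pi)), I.card = n + 1 ∧
        ¬ (⋂ i ∈ I, C i).Nonempty := by
      by_contra! hall
      refine hempty (Convex.helly_theorem_compact (𝕜 := ℝ) (by simp [ENat.card_eq_top_of_infinite])
        hCconv hCcomp fun I hI => hall I (by simpa using hI))
    -- The times are listed in increasing order so that the polygon is inscribed in the curve.
    let t : Fin (n + 1) → ℝ := fun j => I.orderEmbOfFin hIc j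
    have htm : Monotone t := fun i j hij => (I.orderEmbOfFin hIc).monotone hij
    have hlen := polygonLength_le_length hT (hTi.mono interior_subset) (q := fun t => (γ t).1)
      (by simp only [hper]) htm fun j => (I.orderEmbOfFin hIc j).2
    refine le_trans (EReal.coe_le_coe_iff.mpr ?_) hlen
    have hz : NotTranslatable K fun j => r⁻¹ • (γ (t j)).1 := by
      intro v
      by_contra! hall
      refine hI ⟨(1 - r) • c + r • v, ?_⟩
      simp only [Set.mem_iInter]
      intro i hi
      obtain ⟨j, rfl⟩ : ∃ j, I.orderEmbOfFin hIc j = i := by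
        have : i ∈ Set.range (I.orderEmbOfFin hIc) := by simpa using hi
        exact this
      refine ⟨_, interior_subset (hall j), ?_⟩
      simp only [smul_add, smul_inv_smul₀ hr0.ne', t]
      abel
    have h1 := hμ _ hz
    rw [polygonLength_smul T (inv_nonneg.mpr hr0.le), inv_mul_eq_div, le_div_iff₀ hr0] at h1
    linarith
  have hlim : Filter.Tendsto (fun r : ℝ => ((r * μ : ℝ) : EReal)) (nhdsWithin 1 (Set.Iio 1))
      (nhds ((1 * μ : ℝ) : EReal)) :=
    (continuous_coe_real_ereal.comp (continuous_id.mul continuous_const)).continuousAt.tendsto.mono_left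
      nhdsWithin_le_nhds
  rw [one_mul] at hlim
  refine le_of_tendsto hlim ?_
  filter_upwards [Ioo_mem_nhdsLT (zero_lt_one' ℝ)] with r hr using key r hr.1 hr.2

/-! ### Piecewise linear curves -/

section Polyline

variable {V W : Type*} [NormedAddCommGroup V] [NormedSpace ℝ V] [NormedAddCommGroup W]
  [NormedSpace ℝ W]

/-- The piecewise linear curve that is at `a k` at time `k`. -/
def polyline (a : ℤ → V) (s : ℝ) : V := a ⌊s⌋ + Int.fract s • (a (⌊s⌋ + 1) - a ⌊s⌋)

lemma polyline_eq (a : ℤ → V) {k : ℤ} {s : ℝ} (hs : s ∈ Set.Icc (k : ℝ) (k + 1)) :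
    polyline a s = a k + (s - k) • (a (k + 1) - a k) := by
  rcases hs.2.lt_or_eq with h | h
  · have : ⌊s⌋ = k := Int.floor_eq_iff.mpr ⟨hs.1, h⟩
    rw [polyline, Int.fract, this]
  · have h' : s = ((k + 1 : ℤ) : ℝ) := by rw [h]; push_cast; rfl
    rw [polyline, h', Int.floor_intCast, Int.fract_intCast]
    push_cast
    rw [add_sub_cancel_left, zero_smul, one_smul, add_zero, add_sub_cancel]

lemma polyline_intCast (a : ℤ → V) (k : ℤ) : polyline a k = a k := by
  simp [polyline]

lemma polyline_map (f : V →L[ℝ] W) (a : ℤ → V) (s : ℝ) :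
    polyline (fun k => f (a k)) s = f (polyline a s) := by
  simp [polyline]

lemma polyline_periodic {a : ℤ → V} {N : ℤ} (ha : Function.Periodic a N) :
    Function.Periodic (polyline a) N := by
  intro s
  rw [polyline, polyline, Int.floor_add_intCast, Int.fract_add_intCast, ha, add_right_comm, ha]

lemma hasDerivAt_affine (a : ℤ → V) (k : ℤ) (s : ℝ) :
    HasDerivAt (fun s : ℝ => a k + (s - k) • (a (k + 1) - a k)) (a (k + 1) - a k) s := by
  simpa using (((hasDerivAt_id s).sub_const (k : ℝ)).smul_const (a (k + 1) - a k)).const_add (a k)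

lemma hasDerivWithinAt_polyline_right (a : ℤ → V) {k : ℤ} {s : ℝ}
    (hs : s ∈ Set.Ico (k : ℝ) (k + 1)) :
    HasDerivWithinAt (polyline a) (a (k + 1) - a k) (Set.Ici s) s := by
  refine (hasDerivAt_affine a k s).hasDerivWithinAt.congr_of_eventuallyEq ?_
    (polyline_eq a ⟨hs.1, hs.2.le⟩)
  filter_upwards [Icc_mem_nhdsGE hs.2] with x hx using polyline_eq a ⟨hs.1.trans hx.1, hx.2⟩

lemma hasDerivWithinAt_polyline_left (a : ℤ → V) {k : ℤ} {s : ℝ}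
    (hs : s ∈ Set.Ioc (k : ℝ) (k + 1)) :
    HasDerivWithinAt (polyline a) (a (k + 1) - a k) (Set.Iic s) s := by
  refine (hasDerivAt_affine a k s).hasDerivWithinAt.congr_of_eventuallyEq ?_
    (polyline_eq a ⟨hs.1.le, hs.2⟩)
  filter_upwards [Icc_mem_nhdsLE hs.1] with x hx using polyline_eq a ⟨hx.1, hx.2.trans hs.2⟩

lemma polyline_eventuallyEq (a : ℤ → V) {k : ℤ} {s : ℝ} (hs : s ∈ Set.Ioo (k : ℝ) (k + 1)) :
    polyline a =ᶠ[nhds s] fun s => a k + (s - k) • (a (k + 1) - a k) := by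
  filter_upwards [Ioo_mem_nhds hs.1 hs.2] with x hx using polyline_eq a ⟨hx.1.le, hx.2.le⟩

lemma continuous_polyline (a : ℤ → V) : Continuous (polyline a) := by
  refine continuous_iff_continuousAt.mpr fun s => continuousAt_iff_continuous_left_right.mpr ⟨?_, ?_⟩
  · refine (hasDerivWithinAt_polyline_left a (k := ⌈s⌉ - 1) ⟨?_, ?_⟩).continuousWithinAt
    · push_cast
      linarith [Int.ceil_lt_add_one s]
    · push_cast
      linarith [Int.le_ceil s]
  · exact (hasDerivWithinAt_polyline_right a (k := ⌊s⌋)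
      ⟨Int.floor_le s, Int.lt_floor_add_one s⟩).continuousWithinAt

lemma monotoneOn_polyline {a : ℤ → ℝ} (ha : MonotoneOn a (Set.Ici 0)) :
    MonotoneOn (polyline a) (Set.Ici 0) := by
  intro s hs t _ hst
  have h0 : (0 : ℤ) ≤ ⌊s⌋ := Int.floor_nonneg.mpr hs
  have hle : ⌊s⌋ ≤ ⌊t⌋ := Int.floor_le_floor hst
  have hstep : ∀ k : ℤ, 0 ≤ k → 0 ≤ a (k + 1) - a k := fun k hk =>
    sub_nonneg.mpr (ha hk (by simp; omega) (by omega))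
  simp only [polyline, smul_eq_mul]
  have h1 := hstep ⌊s⌋ h0
  have h2 := hstep ⌊t⌋ (h0.trans hle)
  rcases hle.eq_or_lt with h | h
  · have hf : Int.fract s ≤ Int.fract t := by
      rw [Int.fract, Int.fract, h]
      linarith
    rw [← h]
    linarith [mul_le_mul_of_nonneg_right hf h1]
  · have h3 : a (⌊s⌋ + 1) ≤ a ⌊t⌋ := ha (by simp; omega) (h0.trans hle) (by omega)
    have h4 := mul_le_mul_of_nonneg_right (Int.fract_lt_one s).le h1
    have h5 := mul_nonneg (Int.fract_nonneg t) h2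
    linarith

end Polyline

/-! ### Billiard trajectories from bounce points -/

/-- One leg of a piecewise linear trajectory, from `x` to `y`: either a flight or a reflection. -/
def IsLeg (K T : Set (E n)) (x y : E n × E n) : Prop :=
  (∃ u ∈ normalCone T x.2, u ≠ 0 ∧ y - x = (-u, 0)) ∨
    ∃ w ∈ normalCone K x.1, w ≠ 0 ∧ y - x = (0, w)

lemma isLeg_of_mem {K T : Set (E n)} (hKc : Convex ℝ K) (hTc : Convex ℝ T) {x y : E n × E n}
    (hK : IsClosed K) (hT : IsClosed T) (h : IsLeg K T x y) (hx : x ∈ frontier K ×ˢ frontier T)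
    (hy : y ∈ frontier K ×ˢ frontier T) {r : ℝ} (h0 : 0 ≤ r) (h1 : r ≤ 1) :
    ((x + r • (y - x)).1 ∈ K ∧ (x + r • (y - x)).2 ∈ frontier T ∧
      ∃ u ∈ normalCone T (x + r • (y - x)).2, u ≠ 0 ∧ y - x = (-u, 0)) ∨
    ((x + r • (y - x)).1 ∈ frontier K ∧ (x + r • (y - x)).2 ∈ T ∧
      ∃ w ∈ normalCone K (x + r • (y - x)).1, w ≠ 0 ∧ y - x = (0, w)) := by
  have hmem1 : (x + r • (y - x)).1 ∈ K :=
    hKc.add_smul_sub_mem (hK.frontier_subset hx.1) (hK.frontier_subset hy.1) ⟨h0, h1⟩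
  have hmem2 : (x + r • (y - x)).2 ∈ T :=
    hTc.add_smul_sub_mem (hT.frontier_subset hx.2) (hT.frontier_subset hy.2) ⟨h0, h1⟩
  rcases h with ⟨u, hu, hu0, he⟩ | ⟨w, hw, hw0, he⟩
  · have : (x + r • (y - x)).2 = x.2 := by simp [he]
    exact Or.inl ⟨hmem1, this ▸ hx.2, u, this ▸ hu, hu0, he⟩
  · have : (x + r • (y - x)).1 = x.1 := by simp [he]
    exact Or.inr ⟨this ▸ hx.1, hmem2, w, this ▸ hw, hw0, he⟩

/-- A closed chain of legs, run through at constant pace per leg, is a billiard trajectory. -/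
lemma isBilliardTrajectory_polyline {K T : Set (E n)} (hKc : Convex ℝ K) (hTc : Convex ℝ T)
    (hK : IsClosed K) (hT : IsClosed T) {N : ℕ} (hN : 0 < N) {a : ℤ → E n × E n}
    (ha : Function.Periodic a N) (hmem : ∀ i, a i ∈ frontier K ×ˢ frontier T)
    (hleg : ∀ i, IsLeg K T (a i) (a (i + 1))) :
    IsBilliardTrajectory K T fun t => polyline a (N / (2 * Real.pi) * t) := by
  have hpi := Real.two_pi_pos
  set c : ℝ := N / (2 * Real.pi) with hc
  have hc0 : 0 < c := by positivity
  have hpt : ∀ (k : ℤ) (s : ℝ), s ∈ Set.Icc (k : ℝ) (k + 1) →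
      ((polyline a s).1 ∈ K ∧ (polyline a s).2 ∈ frontier T ∧
        ∃ u ∈ normalCone T (polyline a s).2, u ≠ 0 ∧ a (k + 1) - a k = (-u, 0)) ∨
      ((polyline a s).1 ∈ frontier K ∧ (polyline a s).2 ∈ T ∧
        ∃ w ∈ normalCone K (polyline a s).1, w ≠ 0 ∧ a (k + 1) - a k = (0, w)) := by
    intro k s hs
    rw [polyline_eq a hs]
    exact isLeg_of_mem hKc hTc hK hT (hleg k) (hmem k) (hmem (k + 1)) (by linarith [hs.1])
      (by linarith [hs.2])
  have hfl : ∀ s : ℝ, s ∈ Set.Ico (⌊s⌋ : ℝ) (⌊s⌋ + 1) := fun s =>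
    ⟨Int.floor_le s, Int.lt_floor_add_one s⟩
  have hce : ∀ s : ℝ, s ∈ Set.Ioc ((⌈s⌉ - 1 : ℤ) : ℝ) ((⌈s⌉ - 1 : ℤ) + 1) := fun s => by
    constructor <;> push_cast <;> linarith [Int.ceil_lt_add_one s, Int.le_ceil s]
  have hlin : ∀ t : ℝ, HasDerivAt (fun t => c * t) c t := fun t => by
    simpa using (hasDerivAt_id t).const_mul c
  have hright : ∀ t, HasDerivWithinAt (fun t => polyline a (c * t))
      (c • (a (⌊c * t⌋ + 1) - a ⌊c * t⌋)) (Set.Ici t) t := fun t =>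
    (hasDerivWithinAt_polyline_right a (hfl (c * t))).scomp t (hlin t).hasDerivWithinAt
      fun s hs => mul_le_mul_of_nonneg_left hs hc0.le
  have hleft : ∀ t, HasDerivWithinAt (fun t => polyline a (c * t))
      (c • (a (⌈c * t⌉ - 1 + 1) - a (⌈c * t⌉ - 1))) (Set.Iic t) t := fun t =>
    (hasDerivWithinAt_polyline_left a (hce (c * t))).scomp t (hlin t).hasDerivWithinAt
      fun s hs => mul_le_mul_of_nonneg_left hs hc0.le
  have hioo : ∀ s : ℝ, (∀ k : ℤ, (k : ℝ) ≠ s) → s ∈ Set.Ioo (⌊s⌋ : ℝ) (⌊s⌋ + 1) := fun s hs =>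
    ⟨(hfl s).1.lt_of_ne (hs _), (hfl s).2⟩
  have hderiv : ∀ t, (∀ k : ℤ, (k : ℝ) ≠ c * t) → HasDerivAt (fun t => polyline a (c * t))
      (c • (a (⌊c * t⌋ + 1) - a ⌊c * t⌋)) t := fun t ht =>
    HasDerivAt.scomp t ((hasDerivAt_affine a _ _).congr_of_eventuallyEq
      (polyline_eventuallyEq a (hioo _ ht))) (hlin t)
  have hcone : ∀ (k : ℤ) (s : ℝ), s ∈ Set.Icc (k : ℝ) (k + 1) →
      c • (a (k + 1) - a k) ∈ bounceCone K T (polyline a s) := by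
    intro k s hs
    rcases hpt k s hs with ⟨-, -, u, hu, hu0, he⟩ | ⟨-, -, w, hw, hw0, he⟩
    · refine ⟨?_, c • u, smul_mem_normalCone hu hc0.le, 0, zero_mem_normalCone _ _, by simp [he]⟩
      simp [he, hc0.ne', hu0]
    · refine ⟨?_, 0, zero_mem_normalCone _ _, c • w, smul_mem_normalCone hw hc0.le, by simp [he]⟩
      simp [he, hc0.ne', hw0]
  refine ⟨?_, ⟨?_, fun t => ⟨_, hright t⟩, fun t => ⟨_, hleft t⟩, ?_⟩, ?_, ?_, ?_, ?_⟩
  · intro t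
    have : c * (t + 2 * Real.pi) = c * t + ((N : ℤ) : ℝ) := by
      rw [mul_add, hc, div_mul_cancel₀ _ hpi.ne', Int.cast_natCast]
    simp only [this]
    exact polyline_periodic ha _
  · exact (continuous_polyline a).comp (by fun_prop)
  · refine ⟨Set.range fun k : ℤ => (k : ℝ) / c, (Set.countable_range _).measure_zero _,
      fun t ht => ?_⟩
    have hk : ∀ k : ℤ, (k : ℝ) ≠ c * t := fun k h =>
      ht ⟨k, by rw [div_eq_iff hc0.ne', h, mul_comm]⟩
    have hs : ContDiffAt ℝ ∞ (polyline a) (c * t) :=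
      ContDiffAt.congr_of_eventuallyEq (by fun_prop) (polyline_eventuallyEq a (hioo _ hk))
    exact hs.comp t (by fun_prop)
  · intro t
    rw [frontier_prod_eq, hK.closure_eq, hT.closure_eq]
    rcases hpt _ _ ⟨(hfl (c * t)).1, (hfl (c * t)).2.le⟩ with ⟨h1, h2, -⟩ | ⟨h1, h2, -⟩
    · exact Or.inl ⟨h1, h2⟩
    · exact Or.inr ⟨h1, h2⟩
  · intro t hq _
    -- At break points both coordinates lie on the frontiers, so here the time is inside a leg and
    -- the derivative is two-sided.
    have hk : ∀ k : ℤ, (k : ℝ) ≠ c * t := fun k h => by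
      simp only [← h, polyline_intCast] at hq
      exact (hmem k).1.2 hq
    rcases hpt _ _ ⟨(hfl (c * t)).1, (hfl (c * t)).2.le⟩ with ⟨-, -, u, hu, hu0, he⟩ | ⟨h1, -⟩
    · exact ⟨c • u, smul_mem_normalCone hu hc0.le, smul_ne_zero hc0.ne' hu0, by
        simpa [he] using hderiv t hk⟩
    · exact (h1.2 hq).elim
  · intro t _ hp
    have hk : ∀ k : ℤ, (k : ℝ) ≠ c * t := fun k h => by
      simp only [← h, polyline_intCast] at hp
      exact (hmem k).2.2 hp
    rcases hpt _ _ ⟨(hfl (c * t)).1, (hfl (c * t)).2.le⟩ with ⟨-, h2, -⟩ | ⟨-, -, w, hw, hw0, he⟩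
    · exact (h2.2 hp).elim
    · exact ⟨c • w, smul_mem_normalCone hw hc0.le, smul_ne_zero hc0.ne' hw0, by
        simpa [he] using hderiv t hk⟩
  · intro t _ _
    exact ⟨⟨_, hcone _ _ ⟨(hfl (c * t)).1, (hfl (c * t)).2.le⟩, hright t⟩,
      ⟨_, hcone _ _ ⟨(hce (c * t)).1.le, (hce (c * t)).2⟩, hleft t⟩⟩

/-- The length of a piecewise linear curve is at most the sum of the lengths of its pieces. -/
lemma length_polyline_le {T : Set (E n)} (hT : IsCompact T) (hne : T.Nonempty) {N : ℕ}
    (hN : 0 < N) (q : ℤ → E n) :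
    length T (fun t => polyline q (N / (2 * Real.pi) * t)) ≤
      ((∑ i ∈ Finset.range N, supportFn T (q i - q (i + 1)) : ℝ) : EReal) := by
  have hpi := Real.two_pi_pos
  set c : ℝ := N / (2 * Real.pi) with hc
  have hc0 : 0 < c := by positivity
  let ℓ : ℤ → ℝ := fun k => ∑ i ∈ Finset.range k.toNat, supportFn T (q i - q (i + 1))
  have hstep : ∀ s ≥ 0, ∀ t ≥ s,
      supportFn T (polyline q s - polyline q t) ≤ polyline ℓ t - polyline ℓ s := by
    intro s hs t hst
    refine supportFn_le hne fun x hx => ?_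
    -- For fixed `x ∈ T`, each step of `ℓ` dominates the drop of `⟨x, q⟩`. Interpolation preserves
    -- this monotonicity, and the supremum over `x` bounds `h_T`. The restriction to nonnegative
    -- indices matches `toNat` in `ℓ`.
    have hmono : MonotoneOn (fun k => ℓ k + inner ℝ x (q k)) (Set.Ici 0) := by
      intro i hi j _ hij
      refine Int.leInduction (motive := fun j _ => ℓ i + inner ℝ x (q i) ≤ ℓ j + inner ℝ x (q j))
        le_rfl (fun j hj ih => ih.trans ?_) j hij
      lift j to ℕ using le_trans hi hj
      have h1 : ℓ (j + 1) = ℓ j + supportFn T (q j - q (j + 1)) := by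
        have : ((j : ℤ) + 1).toNat = j + 1 := by omega
        simp only [ℓ, this, Int.toNat_natCast, Finset.sum_range_succ]
      have h2 := inner_le_supportFn hT hx (q j - q (j + 1))
      rw [inner_sub_right] at h2
      rw [h1]
      linarith
    have h := monotoneOn_polyline hmono hs (hs.trans hst) hst
    have hadd : ∀ s, polyline (fun k => ℓ k + inner ℝ x (q k)) s =
        polyline ℓ s + inner ℝ x (polyline q s) := fun s => by
      have := polyline_map (innerSL ℝ x) q s
      rw [← innerSL_apply_apply ℝ, ← this]
      simp only [polyline, innerSL_apply_apply, smul_eq_mul]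
      ring
    simp only [hadd] at h
    rw [inner_sub_right]
    linarith
  refine iSup_le fun m => iSup_le fun t => iSup_le fun ⟨ht, h0, hm⟩ => ?_
  refine EReal.coe_le_coe_iff.mpr ?_
  have hnonneg : ∀ i, 0 ≤ t i := fun i => h0 ▸ ht (Nat.zero_le i)
  calc ∑ i ∈ Finset.range m, supportFn T (polyline q (c * t i) - polyline q (c * t (i + 1)))
      ≤ ∑ i ∈ Finset.range m, (polyline ℓ (c * t (i + 1)) - polyline ℓ (c * t i)) :=
        Finset.sum_le_sum fun i _ => hstep _ (mul_nonneg hc0.le (hnonneg i)) _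
          (mul_le_mul_of_nonneg_left (ht i.le_succ) hc0.le)
    _ = polyline ℓ ((N : ℤ) : ℝ) - polyline ℓ ((0 : ℤ) : ℝ) := by
        rw [Finset.sum_range_sub (fun i => polyline ℓ (c * t i)), h0, hm, hc,
          div_mul_cancel₀ _ hpi.ne']
        simp
    _ = ∑ i ∈ Finset.range N, supportFn T (q i - q (i + 1)) := by
        rw [polyline_intCast, polyline_intCast]
        simp [ℓ]

lemma exists_cyclic_index (m : ℕ) : ∃ c : ℤ → Fin (m + 1), (∀ k, c (k + 1) = c k + 1) ∧
    (∀ k, c (k + (m + 1)) = c k) ∧ ∀ i : Fin (m + 1), c (i : ℕ) = i := by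
  -- `Fin (m + 1)` is definitionally `ZMod (m + 1)`, so the cast from `ℤ` is the cyclic index.
  refine ⟨fun k => ((k : ZMod (m + 1)) : ZMod (m + 1)), fun k => ?_, fun k => ?_, fun i => ?_⟩
  · change ((k + 1 : ℤ) : ZMod (m + 1)) = (k : ZMod (m + 1)) + 1
    push_cast
    rfl
  · change ((k + (m + 1) : ℤ) : ZMod (m + 1)) = (k : ZMod (m + 1))
    have : ((m : ZMod (m + 1)) + 1) = 0 := by exact_mod_cast ZMod.natCast_self (m + 1)
    push_cast
    rw [this, add_zero]
  · change (((i : ℕ) : ℤ) : ZMod (m + 1)) = i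
    rw [Int.cast_natCast]
    exact ZMod.natCast_zmod_val (n := m + 1) i

lemma sum_range_two_mul {M : Type*} [AddCommMonoid M] (f : ℕ → M) (N : ℕ) :
    ∑ i ∈ Finset.range (2 * N), f i = ∑ i ∈ Finset.range N, (f (2 * i) + f (2 * i + 1)) := by
  induction N with
  | zero => simp
  | succ N ih =>
    rw [Nat.mul_succ, Finset.sum_range_succ, Finset.sum_range_succ, Finset.sum_range_succ, ih,
      add_assoc]

lemma exists_trajectory {K T : Set (E n)} (hKc : Convex ℝ K) (hTc : Convex ℝ T)
    (hK : IsClosed K) (hT : IsCompact T) (hne : T.Nonempty) {m : ℕ} {q p : Fin (m + 1) → E n}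
    (h : ∀ j, q j ∈ frontier K ∧ p j ∈ frontier T ∧ q j - q (j + 1) ≠ 0 ∧ p j - p (j - 1) ≠ 0 ∧
      p j - p (j - 1) ∈ normalCone K (q j) ∧ q j - q (j + 1) ∈ normalCone T (p j)) :
    ∃ γ, IsBilliardTrajectory K T γ ∧
      length T (fun t => (γ t).1) ≤ ((polygonLength T q : ℝ) : EReal) := by
  obtain ⟨c, hc1, hcN, hci⟩ := exists_cyclic_index m
  -- Even indices give `(q k, p (k - 1))` and odd ones `(q k, p k)`: a reflection at `q k`, then a
  -- flight to `q (k + 1)`. Reflections add no length because `q` rests.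
  let a : ℤ → E n × E n := fun i => (q (c (i / 2)), p (c ((i - 1) / 2)))
  have heven : ∀ k : ℤ, a (2 * k) = (q (c k), p (c k - 1)) := fun k => by
    have h1 : 2 * k / 2 = k := by omega
    have h2 : (2 * k - 1) / 2 = k - 1 := by omega
    have h3 : c k - 1 = c (k - 1) := by rw [sub_eq_iff_eq_add, ← hc1, sub_add_cancel]
    simp only [a, h1, h2, h3]
  have hodd : ∀ k : ℤ, a (2 * k + 1) = (q (c k), p (c k)) := fun k => by
    have h1 : (2 * k + 1) / 2 = k := by omega
    have h2 : (2 * k + 1 - 1) / 2 = k := by omega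
    simp only [a, h1, h2]
  have hnext : ∀ k : ℤ, a (2 * k + 1 + 1) = (q (c k + 1), p (c k)) := fun k => by
    rw [show 2 * k + 1 + 1 = 2 * (k + 1) by ring, heven, hc1, add_sub_cancel_right]
  have hper : Function.Periodic a ((2 * (m + 1) : ℕ) : ℤ) := fun i => by
    have h1 : (i + (2 * (m + 1) : ℕ)) / 2 = i / 2 + (m + 1) := by push_cast; omega
    have h2 : (i + (2 * (m + 1) : ℕ) - 1) / 2 = (i - 1) / 2 + (m + 1) := by push_cast; omega
    simp only [a, h1, h2, hcN]
  have hN : 0 < 2 * (m + 1) := by omega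
  refine ⟨_, isBilliardTrajectory_polyline hKc hTc hK hT.isClosed hN hper
    (fun i => ⟨(h _).1, (h _).2.1⟩) fun i => ?_, ?_⟩
  · obtain ⟨k, rfl | rfl⟩ := Int.even_or_odd' i
    · rw [heven, hodd]
      exact Or.inr ⟨_, (h (c k)).2.2.2.2.1, (h (c k)).2.2.2.1, by simp⟩
    · rw [hodd, hnext]
      exact Or.inl ⟨_, (h (c k)).2.2.2.2.2, (h (c k)).2.2.1, by simp⟩
  · have hfst : ∀ s, (polyline a s).1 = polyline (fun k => (a k).1) s := fun s =>
      (polyline_map (ContinuousLinearMap.fst ℝ (E n) (E n)) a s).symm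
    simp only [hfst]
    refine (length_polyline_le hT hne hN _).trans
      (EReal.coe_le_coe_iff.mpr (le_of_eq ?_))
    rw [sum_range_two_mul, Finset.sum_range, polygonLength]
    refine Finset.sum_congr rfl fun i _ => ?_
    push_cast
    rw [hodd, hnext, heven, hci, sub_self, supportFn_zero hne, zero_add]

/-! ### Shortest trajectories -/

/-- The length of the shortest periodic `T`-billiard trajectory in `K` is the least length of a
polygon with at most `n + 1` vertices that has no translate in the interior of `K`. -/
theorem xiT_characterization (hn : 1 ≤ n) {K T : Set (E n)} (hK : IsSmoothConvexBody K)
    (hT : IsSmoothConvexBody T) :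
    IsLeast (billiardLengths T K) (xiT T K) ∧ ∃ m ≤ n, ∃ z : Fin (m + 1) → E n,
      NotTranslatable K z ∧ xiT T K = ((polygonLength T z : ℝ) : EReal) ∧
      ∀ m' ≤ n, ∀ z' : Fin (m' + 1) → E n, NotTranslatable K z' →
        polygonLength T z ≤ polygonLength T z' := by
  obtain ⟨m, hm, q, p, hq, hmin, h⟩ := exists_bounce_points hn hK.isCompact hK.convex
    hK.interior_nonempty hT.isCompact hT.convex hT.interior_nonempty
  obtain ⟨γ, hγ, hle⟩ := exists_trajectory hK.convex hT.convex hK.isCompact.isClosed hT.isCompact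
    (hT.interior_nonempty.mono interior_subset) h
  have hlower : ∀ γ', IsBilliardTrajectory K T γ' →
      ((polygonLength T q : ℝ) : EReal) ≤ length T fun t => (γ' t).1 := fun γ' hγ' =>
    hγ'.le_length hK.isCompact hK.convex hK.interior_nonempty hT.isCompact hT.interior_nonempty
      (hmin n le_rfl)
  have hleast : IsLeast (billiardLengths T K) ((polygonLength T q : ℝ) : EReal) := by
    refine ⟨⟨γ, hγ, (hlower γ hγ).antisymm hle⟩, ?_⟩
    rintro _ ⟨γ', hγ', rfl⟩
    exact hlower γ' hγ'
  have hxi : xiT T K = ((polygonLength T q : ℝ) : EReal) := hleast.isGLB.sInf_eq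
  exact ⟨hxi ▸ hleast, m, hm, q, hq, hxi, hmin⟩

/-- A minimizing polygon for the larger pair is a competitor for the smaller one, and its length
only drops with `T`. -/
lemma xiT_mono (hn : 1 ≤ n) {K₁ T₁ K₂ T₂ : Set (E n)} (hK₁ : IsSmoothConvexBody K₁)
    (hT₁ : IsSmoothConvexBody T₁) (hK₂ : IsSmoothConvexBody K₂) (hT₂ : IsSmoothConvexBody T₂)
    (hK : K₁ ⊆ K₂) (hT : T₁ ⊆ T₂) : xiT T₁ K₁ ≤ xiT T₂ K₂ := by
  obtain ⟨-, m₁, -, z₁, -, h₁, hmin⟩ := xiT_characterization hn hK₁ hT₁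
  obtain ⟨-, m₂, hm₂, z₂, hz₂, h₂, -⟩ := xiT_characterization hn hK₂ hT₂
  rw [h₁, h₂, EReal.coe_le_coe_iff]
  exact (hmin m₂ hm₂ z₂ (hz₂.anti hK)).trans
    (polygonLength_mono hT₂.isCompact (hT₁.interior_nonempty.mono interior_subset) hT z₂)

/-- The Euclidean unit ball is a smooth convex body. -/
lemma isSmoothConvexBody_closedBall (hn : 1 ≤ n) :
    IsSmoothConvexBody (Metric.closedBall (0 : E n) 1) := by
  refine ⟨convex_closedBall _ _, isCompact_closedBall _ _,
    ⟨0, Metric.ball_subset_interior_closedBall (by simp)⟩, fun x hx => ?_⟩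
  have : Nonempty (Fin n) := ⟨⟨0, hn⟩⟩
  have hx1 : ‖x‖ = 1 := by
    rw [frontier_closedBall _ one_ne_zero] at hx
    simpa using hx
  refine ⟨Set.univ, fun y => ‖y‖ ^ 2 - 1, isOpen_univ, trivial, ?_, by simp [hx1], ?_, ?_⟩
  · exact ((contDiff_norm_sq ℝ).sub contDiff_const).contDiffOn
  · intro h0
    have hd : HasFDerivAt (fun y : E n => ‖y‖ ^ 2 - 1) (2 • innerSL ℝ x) x :=
      (hasStrictFDerivAt_norm_sq x).hasFDerivAt.sub_const 1
    rw [hd.fderiv] at h0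
    have := congrArg (fun f => f x) h0
    simp [hx1] at this
  · ext y
    simp

end MinkowskiBilliard

end

theorem mainTheorem5 (n : ℕ) (hn : 1 ≤ n) :
    -- shortest trajectories exist and have finite length
    (∀ K T : Set (MinkowskiBilliard.E n),
      MinkowskiBilliard.IsSmoothConvexBody K → MinkowskiBilliard.IsSmoothConvexBody T →
        IsLeast (MinkowskiBilliard.billiardLengths T K) (MinkowskiBilliard.xiT T K) ∧
          MinkowskiBilliard.xiT T K ≠ ⊤) ∧
    -- monotonicity for Euclidean billiards
    (∀ K₁ K₂ : Set (MinkowskiBilliard.E n),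
      MinkowskiBilliard.IsSmoothConvexBody K₁ → MinkowskiBilliard.IsSmoothConvexBody K₂ →
        K₁ ⊆ K₂ → MinkowskiBilliard.xi K₁ ≤ MinkowskiBilliard.xi K₂) ∧
    -- monotonicity for Minkowski billiards
    (∀ K₁ T₁ K₂ T₂ : Set (MinkowskiBilliard.E n),
      MinkowskiBilliard.IsSmoothConvexBody K₁ → MinkowskiBilliard.IsSmoothConvexBody T₁ →
        MinkowskiBilliard.IsSmoothConvexBody K₂ → MinkowskiBilliard.IsSmoothConvexBody T₂ →
          K₁ ×ˢ T₁ ⊆ K₂ ×ˢ T₂ →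
            MinkowskiBilliard.xiT T₁ K₁ ≤ MinkowskiBilliard.xiT T₂ K₂) := by
  refine ⟨fun K T hK hT => ?_, fun K₁ K₂ hK₁ hK₂ hK => ?_,
    fun K₁ T₁ K₂ T₂ hK₁ hT₁ hK₂ hT₂ hsub => ?_⟩
  · obtain ⟨h, m, -, z, -, hz, -⟩ := MinkowskiBilliard.xiT_characterization hn hK hT
    exact ⟨h, hz ▸ EReal.coe_ne_top _⟩
  · have hB := MinkowskiBilliard.isSmoothConvexBody_closedBall hn
    exact MinkowskiBilliard.xiT_mono hn hK₁ hB hK₂ hB hK subset_rfl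
  · have hne : (K₁ ×ˢ T₁).Nonempty :=
      (hK₁.interior_nonempty.mono interior_subset).prod (hT₁.interior_nonempty.mono interior_subset)
    -- Inclusion of products splits into inclusions of the factors because the smaller product is
    -- non-empty.
    obtain ⟨hK, hT⟩ := (Set.prod_subset_prod_iff.mp hsub).resolve_right
      (by simpa [Set.prod_nonempty_iff, Set.nonempty_iff_ne_empty] using hne)
    exact MinkowskiBilliard.xiT_mono hn hK₁ hT₁ hK₂ hT₂ hK hT
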